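/- Let $\mathscr{P} \subset \mathbb{H}^4$ be an ideal right-angled polytope, that is, an intersection of finitely many closed half-spaces with non-empty interior and finite volume, all of whose vertices lie on the ideal boundary $\partial\mathbb{H}^4$ and all of whose dihedral angles (at faces of codimension two) are equal to $\pi/2$. Facets are the $3$-dimensional faces of $\mathscr{P}$, and ideal vertices count as faces of $\mathscr{P}$. For $k+\ell = m \geq 3$, a $(k,\ell)$ circuit is a cyclically ordered sequence $F_1,\dots,F_m$ of distinct facets of $\mathscr{P}$ such that - any two cyclically consecutive facets share a face of codimension two or an ideal vertex; exactly $k$ of the $m$ consecutive pairs share a face of codimension two, and the remaining $\ell$ pairs share an ideal vertex but no face of codimension two; - two facets that are not cyclically consecutive share neither a face of codimension two nor an ideal vertex; - no three of the facets have a common face (of any dimension, ideal vertices included). Then $\mathscr{P}$ contains no $(3,0)$, no $(4,0)$ and no $(2,1)$ circuits. -/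

import Mathlib

/-! Hyperbolic space is the upper sheet of the hyperboloid in Minkowski space. -/

namespace IdealPolytope

/-- Minkowski space `ℝ^{n,1}`; the coordinate `0` is the time coordinate. -/
abbrev Mink (n : ℕ) : Type := Fin (n + 1) → ℝ

/-- The Lorentzian form of signature `(n, 1)`. -/
def lorentz {n : ℕ} (x y : Mink n) : ℝ := -(x 0 * y 0) + ∑ i : Fin n, x i.succ * y i.succ

/-- Hyperbolic `n`-space. -/
def hypSpace (n : ℕ) : Set (Mink n) := {x | lorentz x x = -1 ∧ 0 < x 0}

/-- `S ⊆ ℍⁿ` has codimension `c`: it is non-empty and the smallest hyperbolic subspace containing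
it has dimension `n - c`. (A `d`-dimensional hyperbolic subspace is the intersection of `ℍⁿ` with
a linear subspace of dimension `d + 1`.) -/
def HasCodim {n : ℕ} (S : Set (Mink n)) (c : ℕ) : Prop :=
  S.Nonempty ∧ Module.finrank ℝ (Submodule.span ℝ S) + c = n + 1

/-- A full-dimensional polytope in `ℍⁿ`: an intersection of finitely many closed half-spaces
`{x | ⟨x, e⟩ ≤ 0}`, where `e` is a unit space-like vector (the outer unit normal). -/
def IsPolytope {n : ℕ} (P : Set (Mink n)) : Prop :=
  (∃ E : Finset (Mink n), (∀ e ∈ E, lorentz e e = 1) ∧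
    P = {x | x ∈ hypSpace n ∧ ∀ e ∈ E, lorentz x e ≤ 0}) ∧ HasCodim P 0

/-- `e` is an outer unit normal of a supporting hyperplane of `P` that cuts out `F`. -/
def IsOuterNormal {n : ℕ} (P F : Set (Mink n)) (e : Mink n) : Prop :=
  lorentz e e = 1 ∧ (∀ x ∈ P, lorentz x e ≤ 0) ∧ F = {x | x ∈ P ∧ lorentz x e = 0}

/-- `F` is a facet of `P`: the part of `P` in a supporting hyperplane, of dimension `n - 1`. -/
def IsFacet {n : ℕ} (P F : Set (Mink n)) : Prop :=
  HasCodim F 1 ∧ ∃ e, IsOuterNormal P F e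

/-- The dihedral angle of the wedge `{x | ⟨x, e⟩ ≤ 0, ⟨x, e'⟩ ≤ 0}` whose two bounding hyperplanes,
with outer unit normals `e` and `e'`, intersect: `π` minus the angle between the normals. -/
noncomputable def dihedralAngle {n : ℕ} (e e' : Mink n) : ℝ := Real.arccos (-lorentz e e')

/-- All dihedral angles, at the faces of codimension two, are equal to `π / 2`. -/
def IsRightAngled {n : ℕ} (P : Set (Mink n)) : Prop :=
  ∀ F F' : Set (Mink n), IsFacet P F → IsFacet P F' → HasCodim (F ∩ F') 2 →
    ∀ e e' : Mink n, IsOuterNormal P F e → IsOuterNormal P F' e' →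
      dihedralAngle e e' = Real.pi / 2

/-- The closure of `S ⊆ ℍⁿ` in the compactification `ℍⁿ ∪ ∂ℍⁿ`, seen in the projective (Klein)
model, that is, in the closed unit ball of the affine hyperplane `{x | x 0 = 1}`. Points of the
closure are ideal exactly when they are light-like. -/
def kleinClosure {n : ℕ} (S : Set (Mink n)) : Set (Mink n) :=
  closure ((fun x : Mink n => (x 0)⁻¹ • x) '' S)

/-- The vertices of `P`, ordinary or ideal: the extreme points of its closure in the projective
model. -/
def vertices {n : ℕ} (P : Set (Mink n)) : Set (Mink n) := (kleinClosure P).extremePoints ℝ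

/-- The ideal vertices of `P`: the vertices on `∂ℍⁿ`. -/
def idealVertices {n : ℕ} (P : Set (Mink n)) : Set (Mink n) :=
  {v | v ∈ vertices P ∧ lorentz v v = 0}

/-- The point of the hyperboloid above `u ∈ ℝⁿ`. -/
noncomputable def hypLift {n : ℕ} (u : Fin n → ℝ) : Mink n :=
  Fin.cons (Real.sqrt (1 + ∑ i, u i ^ 2)) u

/-- Hyperbolic volume, whose density in the coordinates `u = (x₁, …, xₙ)` of the hyperboloid is
`du / x₀`, with `x₀ = √(1 + |u|²)`. -/
noncomputable def hypVolume {n : ℕ} (S : Set (Mink n)) : ENNReal :=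
  ∫⁻ u in {u : Fin n → ℝ | hypLift u ∈ S}, ENNReal.ofReal (Real.sqrt (1 + ∑ i, u i ^ 2))⁻¹

/-- `P` is ideal: it has finite volume and all its vertices lie on `∂ℍⁿ`. -/
def IsIdeal {n : ℕ} (P : Set (Mink n)) : Prop :=
  hypVolume P < ⊤ ∧ ∀ v ∈ vertices P, v ∈ idealVertices P

/-- Two facets are adjacent through a face of codimension two. -/
def ShareCodimTwo {n : ℕ} (F F' : Set (Mink n)) : Prop := HasCodim (F ∩ F') 2

/-- Two facets of `P` have a common ideal vertex. -/
def ShareIdealVertex {n : ℕ} (P F F' : Set (Mink n)) : Prop :=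
  ∃ v ∈ idealVertices P, v ∈ kleinClosure F ∧ v ∈ kleinClosure F'

/-- Three facets of `P` have a common face, which may be an ideal vertex. -/
def ShareFaceThree {n : ℕ} (P F F' F'' : Set (Mink n)) : Prop :=
  (F ∩ F' ∩ F'').Nonempty ∨
    ∃ v ∈ idealVertices P, v ∈ kleinClosure F ∧ v ∈ kleinClosure F' ∧ v ∈ kleinClosure F''

/-- `F 0, …, F (k + l - 1)` is a `(k, l)` circuit of facets of `P`. Indices are read cyclically:
the successor of `i` is `finRotate _ i`. Of the `k + l` pairs of consecutive facets, `k` share a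
face of codimension two, and the other `l` share only an ideal vertex. -/
structure IsCircuit {n : ℕ} (P : Set (Mink n)) (k l : ℕ) (F : Fin (k + l) → Set (Mink n)) :
    Prop where
  three_le : 3 ≤ k + l
  facet : ∀ i, IsFacet P (F i)
  injective : Function.Injective F
  adjacent : ∀ i, ShareCodimTwo (F i) (F (finRotate _ i)) ∨
    ShareIdealVertex P (F i) (F (finRotate _ i))
  not_adjacent : ∀ i j, i ≠ j → j ≠ finRotate _ i → i ≠ finRotate _ j →
    ¬ ShareCodimTwo (F i) (F j) ∧ ¬ ShareIdealVertex P (F i) (F j)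
  no_three : ∀ i j r, i ≠ j → j ≠ r → i ≠ r → ¬ ShareFaceThree P (F i) (F j) (F r)
  card_codimTwo : {i | ShareCodimTwo (F i) (F (finRotate _ i))}.ncard = k
  card_idealVertex : {i | ¬ ShareCodimTwo (F i) (F (finRotate _ i)) ∧
    ShareIdealVertex P (F i) (F (finRotate _ i))}.ncard = l

/-- `P` contains a `(k, l)` circuit of facets. -/
def ContainsCircuit {n : ℕ} (P : Set (Mink n)) (k l : ℕ) : Prop :=
  ∃ F : Fin (k + l) → Set (Mink n), IsCircuit P k l F

end IdealPolytope

/-! Everything rests on `project_mem_causalCone`: orthogonal projection to the hyperplane of a facet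
preserves the closed cone over a right-angled polytope. Inside that hyperplane, the facet is cut out
by neighbours meeting it in codimension two. Their normals are orthogonal to the normal of the
facet, so projecting leaves their inequalities unchanged.

For three facets A, B, C with A and C both adjacent to B, take a point common to A and C and project
it to B. The normal of B is orthogonal to the other two, so the projection stays on both their
hyperplanes. A point of hyperbolic space gives a common point, which excludes (3,0). An ideal vertex
either lies on B already or projects to a time-like vector, which excludes (2,1).

For four facets A, B, C, D, suppose the normals of A and C have product of absolute value at most 1.
Alternating projections between the two hyperplanes, rescaled in the tangent case, converge to a
nonzero common vector in the cone (`exists_common_causal`), and an extreme point argument yields a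
shared ideal vertex (`shareIdealVertex_of_mem`), which a circuit forbids. The same holds for B and
D. If both products exceed 1 in absolute value, the normals of A, C and those of B, D span
orthogonal planes that each contain a time-like vector, against `lorentz_ne_zero_of_timelike`. -/

namespace IdealPolytope

open Filter Topology

/-! ### Causality in Minkowski space -/

section LorentzForm

variable {n : ℕ}

/-- The Lorentzian form as a bilinear form. -/
noncomputable def lorentzForm (n : ℕ) : Mink n →ₗ[ℝ] Mink n →ₗ[ℝ] ℝ :=
  LinearMap.mk₂ ℝ lorentz
    (fun x y z => by simp only [lorentz, Pi.add_apply, add_mul, Finset.sum_add_distrib]; ring)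
    (fun c x y => by
      simp only [lorentz, Pi.smul_apply, smul_eq_mul, mul_add, Finset.mul_sum, mul_assoc]; ring)
    (fun x y z => by simp only [lorentz, Pi.add_apply, mul_add, Finset.sum_add_distrib]; ring)
    (fun c x y => by
      simp only [lorentz, Pi.smul_apply, smul_eq_mul, mul_add, Finset.mul_sum, mul_left_comm]
      ring)

theorem lorentz_comm (x y : Mink n) : lorentz x y = lorentz y x := by
  simp only [lorentz, mul_comm]

theorem lorentz_add_left (x y z : Mink n) : lorentz (x + y) z = lorentz x z + lorentz y z :=
  (lorentzForm n).map_add₂ x y z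

theorem lorentz_sub_left (x y z : Mink n) : lorentz (x - y) z = lorentz x z - lorentz y z :=
  (lorentzForm n).map_sub₂ x y z

theorem lorentz_smul_left (c : ℝ) (x z : Mink n) : lorentz (c • x) z = c * lorentz x z :=
  (lorentzForm n).map_smul₂ c x z

theorem lorentz_add_right (x y z : Mink n) : lorentz z (x + y) = lorentz z x + lorentz z y :=
  (lorentzForm n z).map_add x y

theorem lorentz_sub_right (x y z : Mink n) : lorentz z (x - y) = lorentz z x - lorentz z y :=
  (lorentzForm n z).map_sub x y

theorem lorentz_smul_right (c : ℝ) (x z : Mink n) : lorentz z (c • x) = c * lorentz z x :=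
  (lorentzForm n z).map_smul c x

theorem lorentz_zero_right (x : Mink n) : lorentz x 0 = 0 := (lorentzForm n x).map_zero

@[fun_prop]
theorem continuous_lorentz {X : Type*} [TopologicalSpace X] {f g : X → Mink n}
    (hf : Continuous f) (hg : Continuous g) : Continuous fun x => lorentz (f x) (g x) := by
  unfold lorentz
  fun_prop

theorem sum_sq_eq (x : Mink n) : ∑ i : Fin n, x i.succ ^ 2 = lorentz x x + x 0 ^ 2 := by
  simp only [lorentz, pow_two]; ring

/-- Cauchy–Schwarz for the spatial parts. -/
theorem sum_mul_sq_le (x y : Mink n) :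
    (lorentz x y + x 0 * y 0) ^ 2 ≤ (lorentz x x + x 0 ^ 2) * (lorentz y y + y 0 ^ 2) := by
  rw [← sum_sq_eq, ← sum_sq_eq]
  have : lorentz x y + x 0 * y 0 = ∑ i : Fin n, x i.succ * y i.succ := by
    simp only [lorentz]; ring
  rw [this]
  exact Finset.sum_mul_sq_le_sq_mul_sq _ _ _

theorem spatial_nonneg (x : Mink n) : 0 ≤ lorentz x x + x 0 ^ 2 := by
  rw [← sum_sq_eq]; positivity

/-- Two future-pointing causal vectors have non-positive Lorentzian product. -/
theorem lorentz_nonpos {x y : Mink n} (hx : lorentz x x ≤ 0) (hx0 : 0 ≤ x 0)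
    (hy : lorentz y y ≤ 0) (hy0 : 0 ≤ y 0) : lorentz x y ≤ 0 := by
  have h : (lorentz x y + x 0 * y 0) ^ 2 ≤ (x 0 * y 0) ^ 2 := by
    refine (sum_mul_sq_le x y).trans ?_
    rw [mul_pow]
    exact mul_le_mul (by linarith) (by linarith) (spatial_nonneg y) (sq_nonneg _)
  have := (abs_le.1 (abs_le_of_sq_le_sq h (mul_nonneg hx0 hy0))).2
  linarith

theorem nonneg_of_lorentz_neg {x y : Mink n} (hx : lorentz x x ≤ 0) (hx0 : 0 ≤ x 0)
    (hy : lorentz y y ≤ 0) (hxy : lorentz x y < 0) : 0 ≤ y 0 := by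
  by_contra! h
  have h1 : lorentz x ((-1 : ℝ) • y) ≤ 0 := lorentz_nonpos hx hx0
    (by rw [lorentz_smul_left, lorentz_smul_right]; linarith) (by simp [h.le])
  rw [lorentz_smul_right] at h1
  linarith

theorem zero_time_pos {x : Mink n} (hx : lorentz x x ≤ 0) (hx0 : 0 ≤ x 0) (hne : x ≠ 0) :
    0 < x 0 := by
  refine lt_of_le_of_ne hx0 fun h => hne ?_
  have h1 : ∑ i : Fin n, x i.succ ^ 2 = 0 := by
    refine le_antisymm ?_ (by positivity)
    rw [sum_sq_eq, ← h]; linarith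
  rw [Finset.sum_eq_zero_iff_of_nonneg fun i _ => sq_nonneg _] at h1
  funext i
  refine Fin.cases h.symm (fun j => ?_) i
  simpa using h1 j (Finset.mem_univ j)

/-- Two time-like vectors are never orthogonal. -/
theorem lorentz_ne_zero_of_timelike {x y : Mink n} (hx : lorentz x x < 0)
    (hy : lorentz y y < 0) : lorentz x y ≠ 0 := by
  intro h
  have h1 := sum_mul_sq_le x y
  have h2 := spatial_nonneg x
  have h3 := spatial_nonneg y
  rw [h, zero_add, mul_pow] at h1
  have : (lorentz x x + x 0 ^ 2) * (lorentz y y + y 0 ^ 2) < x 0 ^ 2 * y 0 ^ 2 :=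
    mul_lt_mul'' (by linarith) (by linarith) h2 h3
  linarith

/-- The open cone of future-pointing time-like vectors. -/
def futureCone (n : ℕ) : Set (Mink n) := {x | lorentz x x < 0 ∧ 0 < x 0}

theorem isOpen_futureCone : IsOpen (futureCone n) :=
  (isOpen_lt (continuous_lorentz continuous_id continuous_id) continuous_const).inter
    (isOpen_lt continuous_const (continuous_apply 0))

theorem smul_mem_futureCone {x : Mink n} {c : ℝ} (hc : 0 < c) (hx : x ∈ futureCone n) :
    c • x ∈ futureCone n := by
  refine ⟨?_, by simpa using mul_pos hc hx.2⟩
  rw [lorentz_smul_left, lorentz_smul_right]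
  exact mul_neg_of_pos_of_neg hc (mul_neg_of_pos_of_neg hc hx.1)

theorem add_mem_futureCone {x y : Mink n} (hx : lorentz x x ≤ 0) (hx0 : 0 ≤ x 0)
    (hy : y ∈ futureCone n) : x + y ∈ futureCone n := by
  refine ⟨?_, by simpa using add_pos_of_nonneg_of_pos hx0 hy.2⟩
  have := lorentz_nonpos hx hx0 hy.1.le hy.2.le
  rw [lorentz_add_left, lorentz_add_right, lorentz_add_right, lorentz_comm y x]
  linarith [hy.1]

theorem hypSpace_subset_futureCone : hypSpace n ⊆ futureCone n :=
  fun x hx => ⟨by rw [hx.1]; norm_num, hx.2⟩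

theorem exists_smul_mem_hypSpace {x : Mink n} (hx : x ∈ futureCone n) :
    ∃ c : ℝ, 0 < c ∧ c • x ∈ hypSpace n := by
  have h : 0 < -lorentz x x := by linarith [hx.1]
  have hs := Real.sqrt_pos.2 h
  refine ⟨(Real.sqrt (-lorentz x x))⁻¹, by positivity, ?_, ?_⟩
  · rw [lorentz_smul_left, lorentz_smul_right]
    have := Real.mul_self_sqrt h.le
    field_simp
    nlinarith
  · simpa using mul_pos (inv_pos.2 hs) hx.2

end LorentzForm

/-! ### Cones over polytopes and irredundant inequalities -/

section Cone

variable {n : ℕ}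

/-- The closed cone over the polytope with outer normals `E`, ideal points included. -/
def causalCone (E : Finset (Mink n)) : Set (Mink n) :=
  {x | lorentz x x ≤ 0 ∧ 0 ≤ x 0 ∧ ∀ e ∈ E, lorentz x e ≤ 0}

/-- The polytope with outer normals `E`. -/
def polytopeOf (E : Finset (Mink n)) : Set (Mink n) :=
  {x | x ∈ hypSpace n ∧ ∀ e ∈ E, lorentz x e ≤ 0}

theorem isClosed_causalCone (E : Finset (Mink n)) : IsClosed (causalCone E) := by
  have : causalCone E = {x | lorentz x x ≤ 0} ∩ ({x | 0 ≤ x 0} ∩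
      ⋂ e ∈ E, {x | lorentz x e ≤ 0}) := by
    ext x; simp [causalCone]
  rw [this]
  refine (isClosed_le (by fun_prop) continuous_const).inter
    ((isClosed_le continuous_const (continuous_apply 0)).inter ?_)
  exact isClosed_biInter fun e _ => isClosed_le (by fun_prop) continuous_const

theorem smul_mem_causalCone {E : Finset (Mink n)} {x : Mink n} {c : ℝ} (hc : 0 ≤ c)
    (hx : x ∈ causalCone E) : c • x ∈ causalCone E := by
  refine ⟨?_, by simpa using mul_nonneg hc hx.2.1, fun e he => ?_⟩
  · rw [lorentz_smul_left, lorentz_smul_right]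
    exact mul_nonpos_of_nonneg_of_nonpos hc (mul_nonpos_of_nonneg_of_nonpos hc hx.1)
  · rw [lorentz_smul_left]
    exact mul_nonpos_of_nonneg_of_nonpos hc (hx.2.2 e he)

theorem polytopeOf_subset_causalCone (E : Finset (Mink n)) : polytopeOf E ⊆ causalCone E :=
  fun _ hx => ⟨(hypSpace_subset_futureCone hx.1).1.le, hx.1.2.le, hx.2⟩

theorem exists_smul_mem_polytopeOf {E : Finset (Mink n)} {x : Mink n} (hx : x ∈ futureCone n)
    (hE : ∀ e ∈ E, lorentz x e ≤ 0) : ∃ c : ℝ, 0 < c ∧ c • x ∈ polytopeOf E := by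
  obtain ⟨c, hc, h⟩ := exists_smul_mem_hypSpace hx
  refine ⟨c, hc, h, fun e he => ?_⟩
  rw [lorentz_smul_left]
  exact mul_nonpos_of_nonneg_of_nonpos hc.le (hE e he)

/-- From finitely many linear inequalities on a convex cone `U` one can choose a subset that
defines the same cone and all of whose inequalities are facet-defining. -/
theorem exists_irredundant (U S : Set (Mink n)) (hadd : ∀ x ∈ U, ∀ y ∈ U, x + y ∈ U)
    (hsmul : ∀ x ∈ U, ∀ c : ℝ, 0 < c → c • x ∈ U) (hS : S ⊆ U) (hne : S.Nonempty)
    (hU : U ⊆ Submodule.span ℝ S) (E : Finset (Mink n))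
    (hE : ∀ x ∈ S, ∀ e ∈ E, lorentz x e ≤ 0) :
    ∃ J ⊆ E, (∀ x ∈ U, (∀ j ∈ J, lorentz x j ≤ 0) → ∀ e ∈ E, lorentz x e ≤ 0) ∧
      ∀ j ∈ J, ∃ w ∈ U, 0 < lorentz w j ∧ ∃ z ∈ U, lorentz z j = 0 ∧
        ∀ i ∈ J, i ≠ j → lorentz z i < 0 := by
  classical
  obtain ⟨J, hJE, hJ⟩ : ∃ J ≤ E, Minimal (fun J : Finset (Mink n) => J ⊆ E ∧
      ∀ x ∈ U, (∀ j ∈ J, lorentz x j ≤ 0) → ∀ e ∈ E, lorentz x e ≤ 0) J :=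
    exists_minimal_le_of_wellFoundedLT _ E ⟨subset_rfl, fun _ _ h => h⟩
  refine ⟨J, hJE, hJ.prop.2, ?_⟩
  -- Otherwise `j` could be erased from `J`, against minimality.
  have hw : ∀ j ∈ J, ∃ w ∈ U, 0 < lorentz w j ∧ ∀ i ∈ J, i ≠ j → lorentz w i ≤ 0 := by
    intro j hj
    by_contra! hcon
    have hmem : j ∈ J.erase j := by
      refine hJ.le_of_le ⟨(Finset.erase_subset _ _).trans hJE, fun x hx h => ?_⟩
        (Finset.erase_subset _ _) hj
      refine hJ.prop.2 x hx fun i hi => ?_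
      by_contra! hpos
      have hij : i = j := by
        by_contra hij
        exact absurd (h i (Finset.mem_erase.2 ⟨hij, hi⟩)) (not_le.2 hpos)
      subst hij
      obtain ⟨k, hk, hki, hk0⟩ := hcon x hx hpos
      exact absurd (h k (Finset.mem_erase.2 ⟨hki, hk⟩)) (not_le.2 hk0)
    simp at hmem
  -- An inequality tight on all of `S` would be tight on its span, hence at `w`.
  have hp : ∀ j ∈ J, ∃ p ∈ S, lorentz p j < 0 := by
    intro j hj
    by_contra! hcon
    obtain ⟨w, hwU, hw0, -⟩ := hw j hj
    have hle : Submodule.span ℝ S ≤ LinearMap.ker ((lorentzForm n).flip j) :=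
      Submodule.span_le.2 fun p hp => le_antisymm (hE p hp j (hJE hj)) (hcon p hp)
    have : lorentz w j = 0 := hle (hU hwU)
    linarith
  obtain ⟨y, hyU, hy⟩ : ∃ y ∈ U, ∀ j ∈ J, lorentz y j < 0 := by
    -- Adding up one strict point per inequality makes all of them strict at once.
    have key : ∀ I ⊆ J, ∃ y ∈ U, (∀ j ∈ J, lorentz y j ≤ 0) ∧ ∀ j ∈ I, lorentz y j < 0 := by
      intro I
      induction I using Finset.induction_on with
      | empty =>
        obtain ⟨p, hp⟩ := hne
        exact fun _ => ⟨p, hS hp, fun j hj => hE p hp j (hJE hj), by simp⟩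
      | insert j I _ ih =>
        intro hI
        obtain ⟨y, hyU, hy, hyI⟩ := ih ((Finset.subset_insert _ _).trans hI)
        obtain ⟨p, hpS, hpj⟩ := hp j (hI (Finset.mem_insert_self _ _))
        refine ⟨y + p, hadd _ hyU _ (hS hpS), fun i hi => ?_, fun i hi => ?_⟩
        · rw [lorentz_add_left]
          linarith [hy i hi, hE p hpS i (hJE hi)]
        · rw [lorentz_add_left]
          rcases Finset.mem_insert.1 hi with rfl | hi'
          · linarith [hy i (hI hi)]
          · linarith [hyI i hi', hE p hpS i (hJE (hI hi))]
    obtain ⟨y, hyU, -, hy⟩ := key J subset_rfl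
    exact ⟨y, hyU, hy⟩
  intro j hj
  obtain ⟨w, hwU, hw0, hwi⟩ := hw j hj
  have hyj := hy j hj
  -- The weights are chosen so that the combination of `y` and `w` falls on the hyperplane of `j`.
  refine ⟨w, hwU, hw0, lorentz w j • y + (-lorentz y j) • w,
    hadd _ (hsmul _ hyU _ hw0) _ (hsmul _ hwU _ (by linarith)), ?_, fun i hi hij => ?_⟩
  · rw [lorentz_add_left, lorentz_smul_left, lorentz_smul_left]; ring
  · rw [lorentz_add_left, lorentz_smul_left, lorentz_smul_left]
    have h1 := mul_neg_of_pos_of_neg hw0 (hy i hi)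
    have h2 := mul_nonpos_of_nonneg_of_nonpos (by linarith : 0 ≤ -lorentz y j) (hwi i hi hij)
    linarith

/-- A set that contains, up to scaling, a neighbourhood of a vector in a subspace spans it. -/
theorem le_span_of_eventually {S : Set (Mink n)} {M : Submodule ℝ (Mink n)} {z : Mink n}
    (h : ∀ v ∈ M, ∀ᶠ t : ℝ in 𝓝 0, ∃ c : ℝ, 0 < c ∧ c • (z + t • v) ∈ S) :
    M ≤ Submodule.span ℝ S := by
  have hmem : ∀ x : Mink n, (∃ c : ℝ, 0 < c ∧ c • x ∈ S) → x ∈ Submodule.span ℝ S := by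
    rintro x ⟨c, hc, hx⟩
    exact ((Submodule.span ℝ S).smul_mem_iff hc.ne').1 (Submodule.subset_span hx)
  intro v hv
  have h1 := h v hv
  have hz : z ∈ Submodule.span ℝ S := by simpa using hmem _ h1.self_of_nhds
  obtain ⟨t, ht, ht0⟩ := ((h1.filter_mono nhdsWithin_le_nhds).and
    (self_mem_nhdsWithin : Set.Ioi (0 : ℝ) ∈ 𝓝[>] 0)).exists
  have h2 := Submodule.sub_mem _ (hmem _ ht) hz
  rw [add_sub_cancel_left] at h2
  exact ((Submodule.span ℝ S).smul_mem_iff (ne_of_gt ht0)).1 h2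

/-- The hyperplane orthogonal to `e`. -/
noncomputable def orthogonalHyperplane (e : Mink n) : Submodule ℝ (Mink n) :=
  LinearMap.ker ((lorentzForm n).flip e)

theorem mem_orthogonalHyperplane {e x : Mink n} :
    x ∈ orthogonalHyperplane e ↔ lorentz x e = 0 := Iff.rfl

theorem finrank_orthogonalHyperplane {e : Mink n} (he : lorentz e e = 1) :
    Module.finrank ℝ (orthogonalHyperplane e) + 1 = n + 1 := by
  have hne : (lorentzForm n).flip e ≠ 0 := by
    intro h
    have : lorentz e e = 0 := congrArg (fun f => f e) h
    linarith
  exact (Module.Dual.finrank_ker_add_one_of_ne_zero hne).trans (Module.finrank_fin_fun ℝ)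

theorem finrank_orthogonalHyperplane_inf {e j w : Mink n} (he : lorentz e e = 1)
    (hwe : lorentz w e = 0) (hwj : lorentz w j ≠ 0) :
    Module.finrank ℝ (orthogonalHyperplane e ⊓ orthogonalHyperplane j :
      Submodule ℝ (Mink n)) + 2 = n + 1 := by
  set f : Module.Dual ℝ (orthogonalHyperplane e) :=
    ((lorentzForm n).flip j).domRestrict (orthogonalHyperplane e)
  have hne : f ≠ 0 := by
    intro h
    exact hwj (congrArg (fun g => g ⟨w, hwe⟩) h)
  have h1 := Module.Dual.finrank_ker_add_one_of_ne_zero hne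
  have h2 := finrank_orthogonalHyperplane he
  have h3 : (LinearMap.ker f).map (orthogonalHyperplane e).subtype =
      orthogonalHyperplane e ⊓ orthogonalHyperplane j := by
    ext x
    simp only [Submodule.mem_map, Submodule.mem_inf]
    constructor
    · rintro ⟨⟨y, hy⟩, hfy, rfl⟩
      exact ⟨hy, hfy⟩
    · rintro ⟨hx, hxj⟩
      exact ⟨⟨x, hx⟩, hxj, rfl⟩
  rw [← h3, Submodule.finrank_map_subtype_eq]
  omega

end Cone

/-! ### Facets, projections and ideal vertices -/

section Polytope

variable {n : ℕ} {E : Finset (Mink n)}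

/-- Being time-like and the strict inequalities are open conditions at `z`; the tight ones do not
change along `v`. The subspace `M` serves both for the whole space and for the hyperplane of a
facet. -/
theorem eventually_pos_smul_mem {J : Finset (Mink n)} {M : Submodule ℝ (Mink n)} {z v : Mink n}
    (hJ : ∀ x ∈ futureCone n, x ∈ M → (∀ j ∈ J, lorentz x j ≤ 0) → ∀ e ∈ E, lorentz x e ≤ 0)
    (hz : z ∈ futureCone n) (hzM : z ∈ M) (hvM : v ∈ M)
    (h : ∀ j ∈ J, lorentz z j < 0 ∨ (lorentz z j = 0 ∧ lorentz v j = 0)) :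
    ∀ᶠ t : ℝ in 𝓝 0, ∃ c : ℝ, 0 < c ∧ c • (z + t • v) ∈ polytopeOf E := by
  have hcont : Continuous fun t : ℝ => z + t • v := by fun_prop
  have h0 : Tendsto (fun t : ℝ => z + t • v) (𝓝 0) (𝓝 z) := by
    simpa using hcont.tendsto 0
  have h1 : ∀ᶠ t : ℝ in 𝓝 0, z + t • v ∈ futureCone n :=
    h0.eventually (isOpen_futureCone.mem_nhds hz)
  have h2 : ∀ᶠ t : ℝ in 𝓝 0, ∀ j ∈ J, lorentz (z + t • v) j ≤ 0 := by
    refine (Finset.eventually_all J).2 fun j hj => ?_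
    rcases h j hj with hneg | ⟨hzj, hvj⟩
    · have hc : Continuous fun x : Mink n => lorentz x j := by fun_prop
      exact (((hc.tendsto z).comp h0).eventually (gt_mem_nhds hneg)).mono fun t ht => ht.le
    · exact Eventually.of_forall fun t => by
        rw [lorentz_add_left, lorentz_smul_left, hzj, hvj]; simp
  filter_upwards [h1, h2] with t ht1 ht2
  exact exists_smul_mem_polytopeOf ht1 (hJ _ ht1 (M.add_mem hzM (M.smul_mem t hvM)) ht2)

/-- A polytope has a presentation whose half-spaces all cut out facets. -/
theorem exists_facet_presentation (hE : ∀ e ∈ E, lorentz e e = 1)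
    (hcod : HasCodim (polytopeOf E) 0) :
    ∃ J ⊆ E, (∀ x ∈ futureCone n, (∀ j ∈ J, lorentz x j ≤ 0) → ∀ e ∈ E, lorentz x e ≤ 0) ∧
      ∀ j ∈ J, HasCodim {x | x ∈ polytopeOf E ∧ lorentz x j = 0} 1 := by
  have htop : Submodule.span ℝ (polytopeOf E) = ⊤ := by
    refine Submodule.eq_top_of_finrank_eq ?_
    rw [← add_zero (Module.finrank ℝ (Submodule.span ℝ (polytopeOf E))), hcod.2]
    simp
  obtain ⟨J, hJE, hJ, hwz⟩ := exists_irredundant (futureCone n) (polytopeOf E)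
    (fun x hx y hy => add_mem_futureCone hx.1.le hx.2.le hy)
    (fun x hx c hc => smul_mem_futureCone hc hx)
    (fun x hx => hypSpace_subset_futureCone hx.1) hcod.1
    (by rw [htop]; exact Set.subset_univ _) E (fun x hx => hx.2)
  refine ⟨J, hJE, hJ, fun j hj => ?_⟩
  obtain ⟨-, -, -, z, hzU, hzj, hzi⟩ := hwz j hj
  have hev : ∀ v ∈ orthogonalHyperplane j, ∀ᶠ t : ℝ in 𝓝 0, ∃ c : ℝ, 0 < c ∧
      c • (z + t • v) ∈ {x | x ∈ polytopeOf E ∧ lorentz x j = 0} := by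
    intro v hv
    refine (eventually_pos_smul_mem (M := ⊤) (v := v) (fun x hx _ => hJ x hx) hzU trivial trivial
      fun i hi => ?_).mono ?_
    · by_cases hij : i = j
      · subst hij; exact Or.inr ⟨hzj, hv⟩
      · exact Or.inl (hzi i hi hij)
    · rintro t ⟨c, hc, hmem⟩
      refine ⟨c, hc, hmem, ?_⟩
      rw [lorentz_smul_left, lorentz_add_left, lorentz_smul_left, hzj,
        mem_orthogonalHyperplane.1 hv]
      simp
  have hspan : Submodule.span ℝ {x | x ∈ polytopeOf E ∧ lorentz x j = 0} =
      orthogonalHyperplane j :=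
    le_antisymm (Submodule.span_le.2 fun x hx => hx.2) (le_span_of_eventually hev)
  obtain ⟨c, -, hmem⟩ := (hev 0 (Submodule.zero_mem _)).self_of_nhds
  refine ⟨⟨_, hmem⟩, ?_⟩
  rw [hspan]
  exact finrank_orthogonalHyperplane (hE j (hJE hj))

/-- The facet `F` with normal `e` is cut out of its hyperplane by those facets of the polytope
that meet it in codimension two. -/
theorem exists_adjacent_presentation (hE : ∀ e ∈ E, lorentz e e = 1)
    (hcod : HasCodim (polytopeOf E) 0) {e : Mink n} (he : lorentz e e = 1)
    (hF : HasCodim {x | x ∈ polytopeOf E ∧ lorentz x e = 0} 1) :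
    ∃ J ⊆ E, (∀ x ∈ futureCone n, lorentz x e = 0 → (∀ j ∈ J, lorentz x j ≤ 0) →
        ∀ i ∈ E, lorentz x i ≤ 0) ∧
      ∀ j ∈ J, HasCodim {x | x ∈ polytopeOf E ∧ lorentz x j = 0} 1 ∧
        HasCodim ({x | x ∈ polytopeOf E ∧ lorentz x e = 0} ∩
          {x | x ∈ polytopeOf E ∧ lorentz x j = 0}) 2 := by
  obtain ⟨I, hIE, hI, hfacet⟩ := exists_facet_presentation hE hcod
  have hspan : Submodule.span ℝ {x | x ∈ polytopeOf E ∧ lorentz x e = 0} =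
      orthogonalHyperplane e := by
    refine Submodule.eq_of_le_of_finrank_eq (Submodule.span_le.2 fun x hx => hx.2) ?_
    have h1 := hF.2
    have h2 := finrank_orthogonalHyperplane he
    omega
  obtain ⟨J, hJI, hJ, hwz⟩ := exists_irredundant (futureCone n ∩ {x | lorentz x e = 0})
    {x | x ∈ polytopeOf E ∧ lorentz x e = 0}
    (fun x hx y hy => ⟨add_mem_futureCone hx.1.1.le hx.1.2.le hy.1, by
      rw [Set.mem_ofPred_eq, lorentz_add_left, hx.2, hy.2, add_zero]⟩)
    (fun x hx c hc => ⟨smul_mem_futureCone hc hx.1, by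
      rw [Set.mem_ofPred_eq, lorentz_smul_left, hx.2, mul_zero]⟩)
    (fun x hx => ⟨hypSpace_subset_futureCone hx.1.1, hx.2⟩) hF.1
    (by rw [hspan]; exact fun x hx => hx.2) I (fun x hx i hi => hx.1.2 i (hIE hi))
  refine ⟨J, hJI.trans hIE, fun x hx hxe h => hI x hx (hJ x ⟨hx, hxe⟩ h),
    fun j hj => ⟨hfacet j (hJI hj), ?_⟩⟩
  -- `w` shows that the hyperplanes of `e` and `j` differ; near `z` their intersection lies in the
  -- cone over the polytope.
  obtain ⟨w, hwU, hwj, z, hzU, hzj, hzi⟩ := hwz j hj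
  set S : Set (Mink n) := {x | x ∈ polytopeOf E ∧ lorentz x e = 0} ∩
    {x | x ∈ polytopeOf E ∧ lorentz x j = 0} with hS
  have hev : ∀ v ∈ orthogonalHyperplane e ⊓ orthogonalHyperplane j, ∀ᶠ t : ℝ in 𝓝 0,
      ∃ c : ℝ, 0 < c ∧ c • (z + t • v) ∈ S := by
    intro v hv
    have hve : lorentz v e = 0 := hv.1
    have hvj : lorentz v j = 0 := hv.2
    refine (eventually_pos_smul_mem (M := orthogonalHyperplane e)
      (fun x hx hxe h => hI x hx (hJ x ⟨hx, hxe⟩ h)) hzU.1 hzU.2 hve fun i hi => ?_).mono ?_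
    · by_cases hij : i = j
      · subst hij; exact Or.inr ⟨hzj, hvj⟩
      · exact Or.inl (hzi i hi hij)
    · rintro t ⟨c, hc, hmem⟩
      refine ⟨c, hc, ⟨hmem, ?_⟩, hmem, ?_⟩
      · rw [lorentz_smul_left, lorentz_add_left, lorentz_smul_left, hzU.2, hve]; simp
      · rw [lorentz_smul_left, lorentz_add_left, lorentz_smul_left, hzj, hvj]; simp
  have hspanS : Submodule.span ℝ S = orthogonalHyperplane e ⊓ orthogonalHyperplane j :=
    le_antisymm (Submodule.span_le.2 fun x hx => ⟨hx.1.2, hx.2.2⟩) (le_span_of_eventually hev)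
  obtain ⟨c, -, hmem⟩ := (hev 0 (Submodule.zero_mem _)).self_of_nhds
  refine ⟨⟨_, hmem⟩, ?_⟩
  rw [hspanS]
  exact finrank_orthogonalHyperplane_inf he hwU.2 hwj.ne'

theorem orthogonal_of_shareCodimTwo {P F F' : Set (Mink n)} {e e' : Mink n}
    (hRight : IsRightAngled P) (hF : IsFacet P F) (hF' : IsFacet P F') (h : ShareCodimTwo F F')
    (he : IsOuterNormal P F e) (he' : IsOuterNormal P F' e') : lorentz e e' = 0 := by
  have h1 := hRight F F' hF hF' h e e' he he'
  rw [dihedralAngle, Real.arccos_eq_pi_div_two] at h1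
  linarith

/-- In a right-angled polytope, the orthogonal projection to the hyperplane of a facet maps the
closed cone over the polytope to itself. -/
theorem project_mem_causalCone (hE : ∀ e ∈ E, lorentz e e = 1)
    (hcod : HasCodim (polytopeOf E) 0) (hRight : IsRightAngled (polytopeOf E))
    {F : Set (Mink n)} {e : Mink n} (hF : HasCodim F 1) (he : IsOuterNormal (polytopeOf E) F e)
    {x : Mink n} (hx : x ∈ causalCone E) (hxe : lorentz x e ≤ 0) :
    x - lorentz x e • e ∈ causalCone E := by
  obtain ⟨hee, heP, rfl⟩ := he
  rcases hxe.eq_or_lt with h0 | hneg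
  · rwa [h0, zero_smul, sub_zero]
  obtain ⟨J, hJE, hJ, hadj⟩ := exists_adjacent_presentation hE hcod hee hF
  set y := x - lorentz x e • e with hy
  have hye : lorentz y e = 0 := by
    rw [hy, lorentz_sub_left, lorentz_smul_left, hee]; ring
  have hyy : lorentz y y ≤ 0 := by
    have : lorentz y y = lorentz x x - lorentz x e ^ 2 := by
      rw [hy, lorentz_sub_left, lorentz_sub_right, lorentz_sub_right, lorentz_smul_left,
        lorentz_smul_left, lorentz_smul_right, lorentz_smul_right, hee, lorentz_comm e x]
      ring
    nlinarith [hx.1]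
  have hy0 : 0 ≤ y 0 := by
    -- The product of `x` and `y` is `lorentz x x - lorentz x e ^ 2`, which is negative.
    refine nonneg_of_lorentz_neg hx.1 hx.2.1 hyy ?_
    rw [hy, lorentz_sub_right, lorentz_smul_right]
    nlinarith [hx.1]
  have hyJ : ∀ j ∈ J, lorentz y j ≤ 0 := by
    intro j hj
    obtain ⟨hj1, hj2⟩ := hadj j hj
    have hnj : IsOuterNormal (polytopeOf E) {x | x ∈ polytopeOf E ∧ lorentz x j = 0} j :=
      ⟨hE j (hJE hj), fun z hz => hz.2 j (hJE hj), rfl⟩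
    have hej := orthogonal_of_shareCodimTwo hRight ⟨hF, e, hee, heP, rfl⟩ ⟨hj1, j, hnj⟩ hj2
      ⟨hee, heP, rfl⟩ hnj
    rw [hy, lorentz_sub_left, lorentz_smul_left, hej, mul_zero, sub_zero]
    exact hx.2.2 j (hJE hj)
  refine ⟨hyy, hy0, fun i hi => ?_⟩
  -- `hJ` only covers time-like vectors and `y` may be light-like, so `y` is pushed towards a point
  -- `p` of the facet and the push tends to zero.
  obtain ⟨p, hp, hpe⟩ := hF.1
  have hpT := hypSpace_subset_futureCone hp.1
  have hle : ∀ t : ℝ, 0 < t → lorentz (y + t • p) i ≤ 0 := by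
    intro t ht
    refine hJ _ (add_mem_futureCone hyy hy0 (smul_mem_futureCone ht hpT)) ?_ (fun j hj => ?_) i hi
    · rw [lorentz_add_left, lorentz_smul_left, hye, hpe]; simp
    · rw [lorentz_add_left, lorentz_smul_left]
      have := mul_nonpos_of_nonneg_of_nonpos ht.le (hp.2 j (hJE hj))
      linarith [hyJ j hj]
  have hcont : Continuous fun t : ℝ => lorentz (y + t • p) i := by fun_prop
  have hlim : Tendsto (fun t : ℝ => lorentz (y + t • p) i) (𝓝[>] 0) (𝓝 (lorentz y i)) := by
    simpa using (hcont.tendsto 0).mono_left nhdsWithin_le_nhds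
  exact le_of_tendsto hlim (eventually_mem_nhdsWithin.mono fun t ht => hle t ht)

theorem exists_smul_mem_of_timelike {x : Mink n} (hx : x ∈ causalCone E) (hxx : lorentz x x < 0) :
    ∃ c : ℝ, 0 < c ∧ c • x ∈ polytopeOf E := by
  refine exists_smul_mem_polytopeOf ⟨hxx, zero_time_pos hx.1 hx.2.1 ?_⟩ hx.2.2
  rintro rfl
  rw [lorentz_zero_right] at hxx
  exact lt_irrefl _ hxx

theorem kleinClosure_subset (P : Set (Mink n)) (hP : P ⊆ polytopeOf E) :
    kleinClosure P ⊆ {x | x 0 = 1} ∩ causalCone E := by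
  refine closure_minimal ?_ ((isClosed_eq (continuous_apply 0) continuous_const).inter
    (isClosed_causalCone E))
  rintro _ ⟨x, hx, rfl⟩
  have h := polytopeOf_subset_causalCone E (hP hx)
  have h0 := (hP hx).1.2
  refine ⟨?_, smul_mem_causalCone (inv_pos.2 h0).le h⟩
  simp [h0.ne']

/-- A possibly ideal `v` is the limit of the rays through `v + t • p`, for any point `p` of the
face, as `t` decreases to 0. -/
theorem mem_kleinClosure {e v : Mink n} (hne : {x | x ∈ polytopeOf E ∧ lorentz x e = 0}.Nonempty)
    (hv : v ∈ causalCone E) (hv0 : v 0 = 1) (hve : lorentz v e = 0) :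
    v ∈ kleinClosure {x | x ∈ polytopeOf E ∧ lorentz x e = 0} := by
  obtain ⟨p, hp, hpe⟩ := hne
  have hpT := hypSpace_subset_futureCone hp.1
  have hmem : ∀ t : ℝ, 0 < t → ((v + t • p) 0)⁻¹ • (v + t • p) ∈
      (fun x : Mink n => (x 0)⁻¹ • x) '' {x | x ∈ polytopeOf E ∧ lorentz x e = 0} := by
    intro t ht
    have hT := add_mem_futureCone hv.1 hv.2.1 (smul_mem_futureCone ht hpT)
    obtain ⟨c, hc, hcm⟩ := exists_smul_mem_polytopeOf (E := E) hT fun i hi => by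
      rw [lorentz_add_left, lorentz_smul_left]
      have := mul_nonpos_of_nonneg_of_nonpos ht.le (hp.2 i hi)
      linarith [hv.2.2 i hi]
    refine ⟨_, ⟨hcm, ?_⟩, ?_⟩
    · rw [lorentz_smul_left, lorentz_add_left, lorentz_smul_left, hve, hpe]; simp
    · simp only [Pi.smul_apply, smul_smul, smul_eq_mul]
      congr 1
      have := hT.2
      field_simp
  have hcont : ContinuousAt (fun t : ℝ => ((v + t • p) 0)⁻¹ • (v + t • p)) 0 := by
    have h1 : Continuous fun t : ℝ => v + t • p := by fun_prop
    have h2 : Continuous fun t : ℝ => (v + t • p) 0 := (continuous_apply 0).comp h1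
    exact (h2.continuousAt.inv₀ (by simp [hv0])).smul h1.continuousAt
  have hlim : Tendsto (fun t : ℝ => ((v + t • p) 0)⁻¹ • (v + t • p)) (𝓝[>] 0) (𝓝 v) := by
    have := hcont.tendsto.mono_left (nhdsWithin_le_nhds (s := Set.Ioi (0 : ℝ)))
    simpa [hv0] using this
  exact mem_closure_of_tendsto hlim (eventually_mem_nhdsWithin.mono fun t ht => hmem t ht)

theorem isCompact_kleinClosure {P : Set (Mink n)} (hP : P ⊆ polytopeOf E) :
    IsCompact (kleinClosure P) := by
  refine (isCompact_closedBall (0 : Mink n) 1).of_isClosed_subset isClosed_closure fun x hx => ?_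
  obtain ⟨hx0, hxx, -⟩ := kleinClosure_subset P hP hx
  rw [Set.mem_ofPred_eq] at hx0
  rw [mem_closedBall_zero_iff, pi_norm_le_iff_of_nonneg zero_le_one]
  have hsum := sum_sq_eq x
  intro i
  refine Fin.cases (by simp [hx0]) (fun j => ?_) i
  have h1 := Finset.single_le_sum (f := fun j : Fin n => x j.succ ^ 2)
    (fun j _ => sq_nonneg _) (Finset.mem_univ j)
  rw [Real.norm_eq_abs, ← sq_le_one_iff_abs_le_one]
  rw [hx0] at hsum
  linarith

/-- Two facets of an ideal polytope whose hyperplanes meet in a point of the closed cone over the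
polytope have a common ideal vertex. -/
theorem shareIdealVertex_of_mem (hne : (polytopeOf E).Nonempty) (hideal : IsIdeal (polytopeOf E))
    {F F' : Set (Mink n)} {e e' : Mink n} (hF : F.Nonempty) (hF' : F'.Nonempty)
    (he : IsOuterNormal (polytopeOf E) F e) (he' : IsOuterNormal (polytopeOf E) F' e')
    {w : Mink n} (hw : w ∈ causalCone E) (hw0 : w ≠ 0) (hwe : lorentz w e = 0)
    (hwe' : lorentz w e' = 0) : ShareIdealVertex (polytopeOf E) F F' := by
  obtain ⟨-, heP, rfl⟩ := he
  obtain ⟨-, heP', rfl⟩ := he'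
  have hwpos := zero_time_pos hw.1 hw.2.1 hw0
  -- The zero normal presents the polytope as a face of itself, so that `mem_kleinClosure` applies.
  have hzero : {x | x ∈ polytopeOf E ∧ lorentz x 0 = 0} = polytopeOf E := by
    ext x; simp [lorentz_zero_right]
  have hwQ : (w 0)⁻¹ • w ∈ kleinClosure (polytopeOf E) := by
    have := mem_kleinClosure (E := E) (e := 0) (by rwa [hzero])
      (smul_mem_causalCone (inv_pos.2 hwpos).le hw) (by simp [hwpos.ne']) (lorentz_zero_right _)
    rwa [hzero] at this
  have hface : ∀ {a : Mink n}, (∀ x ∈ polytopeOf E, lorentz x a ≤ 0) →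
      ∀ x ∈ kleinClosure (polytopeOf E), lorentz x a ≤ 0 := by
    intro a ha
    refine closure_minimal ?_ (isClosed_le (f := fun x : Mink n => lorentz x a) (by fun_prop)
      continuous_const)
    rintro _ ⟨x, hx, rfl⟩
    change lorentz ((x 0)⁻¹ • x) a ≤ 0
    rw [lorentz_smul_left]
    exact mul_nonpos_of_nonneg_of_nonpos (inv_pos.2 hx.1.2).le (ha x hx)
  set Q := kleinClosure (polytopeOf E) ∩ {x | lorentz x e = 0 ∧ lorentz x e' = 0} with hQ
  have hQc : IsCompact Q := (isCompact_kleinClosure subset_rfl).inter_right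
    ((isClosed_eq (continuous_lorentz continuous_id continuous_const) continuous_const).inter
      (isClosed_eq (continuous_lorentz continuous_id continuous_const) continuous_const))
  have hQne : Q.Nonempty := ⟨_, hwQ, by rw [lorentz_smul_left, hwe, mul_zero],
    by rw [lorentz_smul_left, hwe', mul_zero]⟩
  have hext : IsExtreme ℝ (kleinClosure (polytopeOf E)) Q := by
    refine ⟨Set.inter_subset_left, ?_⟩
    rintro x hx y hy z hz ⟨a, b, ha, hb, hab, rfl⟩
    obtain ⟨-, h1, h2⟩ := hz
    rw [lorentz_add_left, lorentz_smul_left, lorentz_smul_left] at h1 h2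
    refine ⟨hx, ?_, ?_⟩
    · nlinarith [hface heP x hx, hface heP y hy]
    · nlinarith [hface heP' x hx, hface heP' y hy]
  -- An extreme point of the compact face `Q` is a vertex of the polytope, hence ideal.
  obtain ⟨v, hv⟩ := hQc.extremePoints_nonempty hQne
  have hvP := hideal.2 v (hext.extremePoints_subset_extremePoints hv)
  obtain ⟨hvK, hve, hve'⟩ := hv.1
  obtain ⟨hv0, hvC⟩ := kleinClosure_subset _ subset_rfl hvK
  exact ⟨v, hvP, mem_kleinClosure hF hvC hv0 hve, mem_kleinClosure hF' hvC hv0 hve'⟩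

end Polytope

/-! ### Consequences of projection for adjacent facets -/

section RightAngled

variable {n : ℕ} {E : Finset (Mink n)}

theorem lorentz_outerNormal_nonpos {F : Set (Mink n)} {e x : Mink n}
    (hne : (polytopeOf E).Nonempty) (he : IsOuterNormal (polytopeOf E) F e)
    (hx : x ∈ causalCone E) : lorentz x e ≤ 0 := by
  obtain ⟨p, hp⟩ := hne
  have hpT := hypSpace_subset_futureCone hp.1
  have hle : ∀ t : ℝ, 0 < t → lorentz (x + t • p) e ≤ 0 := by
    intro t ht
    obtain ⟨c, hc, hmem⟩ := exists_smul_mem_polytopeOf (E := E)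
      (add_mem_futureCone hx.1 hx.2.1 (smul_mem_futureCone ht hpT)) fun i hi => by
        rw [lorentz_add_left, lorentz_smul_left]
        have := mul_nonpos_of_nonneg_of_nonpos ht.le (hp.2 i hi)
        linarith [hx.2.2 i hi]
    have := he.2.1 _ hmem
    rw [lorentz_smul_left] at this
    exact nonpos_of_mul_nonpos_right this hc
  have hcont : Continuous fun t : ℝ => lorentz (x + t • p) e := by fun_prop
  have hlim : Tendsto (fun t : ℝ => lorentz (x + t • p) e) (𝓝[>] 0) (𝓝 (lorentz x e)) := by
    simpa using (hcont.tendsto 0).mono_left nhdsWithin_le_nhds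
  exact le_of_tendsto hlim (eventually_mem_nhdsWithin.mono fun t ht => hle t ht)

/-- If the hyperplanes of two facets of a right-angled polytope intersect or are tangent at
infinity, then they meet in a point of the closed cone over the polytope. -/
theorem exists_common_causal (hE : ∀ e ∈ E, lorentz e e = 1)
    (hcod : HasCodim (polytopeOf E) 0) (hRight : IsRightAngled (polytopeOf E))
    {F F' : Set (Mink n)} {e e' : Mink n} (hF : HasCodim F 1) (hF' : HasCodim F' 1)
    (he : IsOuterNormal (polytopeOf E) F e) (he' : IsOuterNormal (polytopeOf E) F' e')
    (hne : F ≠ F') (hle : lorentz e e' ^ 2 ≤ 1) :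
    ∃ w ∈ causalCone E, w ≠ 0 ∧ lorentz w e = 0 ∧ lorentz w e' = 0 := by
  obtain ⟨x, hxF⟩ := hF.1
  have hx : x ∈ polytopeOf E ∧ lorentz x e = 0 := by rwa [he.2.2] at hxF
  have hxx : lorentz x x = -1 := hx.1.1.1
  set c := lorentz e e' with hc
  set a := lorentz x e' with ha
  -- On the hyperplane of `e`, projecting to that of `e'` and back subtracts a multiple of `u`; each
  -- round trip multiplies the product with `e'` by `c ^ 2`.
  set u := e' - c • e with hu
  have hue : lorentz u e = 0 := by
    rw [hu, lorentz_sub_left, lorentz_smul_left, he.1, lorentz_comm e' e, ← hc]; ring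
  have hue' : lorentz u e' = 1 - c ^ 2 := by
    rw [hu, lorentz_sub_left, lorentz_smul_left, he'.1, ← hc]; ring
  have hux : lorentz u x = a := by
    rw [hu, lorentz_sub_left, lorentz_smul_left, lorentz_comm e x, hx.2, lorentz_comm e' x]; ring
  have hstep : ∀ N : ℕ, x - (a * ∑ i ∈ Finset.range N, (c ^ 2) ^ i) • u ∈ causalCone E := by
    intro N
    induction N with
    | zero => simpa using polytopeOf_subset_causalCone E hx.1
    | succ N ih =>
      set y := x - (a * ∑ i ∈ Finset.range N, (c ^ 2) ^ i) • u with hy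
      have hye : lorentz y e = 0 := by
        rw [hy, lorentz_sub_left, lorentz_smul_left, hue, hx.2]; ring
      have hye' : lorentz y e' = a * (c ^ 2) ^ N := by
        rw [hy, lorentz_sub_left, lorentz_smul_left, hue', ← ha]
        linear_combination (-a) * mul_neg_geom_sum (c ^ 2) N
      have h1 := project_mem_causalCone hE hcod hRight hF' he' ih
        (lorentz_outerNormal_nonpos hcod.1 he' ih)
      have h2 := project_mem_causalCone hE hcod hRight hF he h1
        (lorentz_outerNormal_nonpos hcod.1 he h1)
      convert h2 using 1
      rw [hye', lorentz_sub_left, lorentz_smul_left, hye, lorentz_comm e' e, ← hc,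
        Finset.sum_range_succ, hy, hu]
      module
  rcases hle.lt_or_eq with hlt | heq
  · have hlim : Tendsto (fun N : ℕ => x - (a * ∑ i ∈ Finset.range N, (c ^ 2) ^ i) • u) atTop
        (𝓝 (x - (a * (1 - c ^ 2)⁻¹) • u)) :=
      ((((hasSum_geometric_of_lt_one (sq_nonneg c) hlt).tendsto_sum_nat).const_mul a).smul_const
        u).const_sub x
    have hq : 0 < 1 - c ^ 2 := by linarith
    refine ⟨_, (isClosed_causalCone E).mem_of_tendsto hlim (Eventually.of_forall hstep),
      fun h0 => ?_, ?_, ?_⟩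
    -- The limit has product `-1 - a ^ 2 / (1 - c ^ 2)` with `x`, so it is not zero.
    · have h1 : lorentz (x - (a * (1 - c ^ 2)⁻¹) • u) x = 0 := by
        rw [h0, lorentz_comm, lorentz_zero_right]
      rw [lorentz_sub_left, lorentz_smul_left, hux, hxx] at h1
      have : 0 ≤ a * a * (1 - c ^ 2)⁻¹ := mul_nonneg (mul_self_nonneg a) (inv_pos.2 hq).le
      linarith
    · rw [lorentz_sub_left, lorentz_smul_left, hue, hx.2]; ring
    · rw [lorentz_sub_left, lorentz_smul_left, hue', ← ha]
      field_simp
      ring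
  · by_cases ha0 : a = 0
    · refine ⟨x, polytopeOf_subset_causalCone E hx.1, ?_, hx.2, ha0⟩
      rintro rfl
      rw [lorentz_zero_right] at hxx
      norm_num at hxx
    -- In the tangent case the iterates diverge linearly; after `N + 1` round trips, division by `N
    -- + 1` leaves the limit `-a • u`.
    have hlim : Tendsto (fun N : ℕ => (1 / ((N : ℝ) + 1)) • x - a • u) atTop
        (𝓝 ((0 : ℝ) • x - a • u)) :=
      (tendsto_one_div_add_atTop_nhds_zero_nat.smul_const x).sub_const _
    refine ⟨_, (isClosed_causalCone E).mem_of_tendsto hlim (Eventually.of_forall fun N => ?_),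
      fun h0 => ?_, ?_, ?_⟩
    · have hpos : (0 : ℝ) < (N : ℝ) + 1 := by positivity
      convert smul_mem_causalCone (one_div_pos.2 hpos).le (hstep (N + 1)) using 1
      have hsum : a * ∑ i ∈ Finset.range (N + 1), (c ^ 2) ^ i = ((N : ℝ) + 1) * a := by
        simp [heq, mul_comm]
      rw [hsum, smul_sub (1 / ((N : ℝ) + 1)) x, smul_smul (1 / ((N : ℝ) + 1)), ← mul_assoc,
        one_div_mul_cancel hpos.ne', one_mul]
    -- If `u` vanished, the normals would be proportional and the facets equal.
    · have hu0 : u = 0 := by simpa [ha0] using h0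
      have he'e : e' = c • e := sub_eq_zero.1 hu0
      have hc0 : c ≠ 0 := by rintro h; rw [h] at heq; norm_num at heq
      apply hne
      rw [he.2.2, he'.2.2]
      ext z
      simp [he'e, lorentz_smul_right, hc0]
    · rw [lorentz_sub_left, lorentz_smul_left, lorentz_smul_left, hue]; ring
    · rw [lorentz_sub_left, lorentz_smul_left, lorentz_smul_left, hue', heq]; ring

/-- Projecting `w` along `b` keeps it orthogonal to `a` and `c`; `hneg` says that the result is
time-like, so it rescales to a point of the polytope. -/
theorem inter_nonempty_of_project (hE : ∀ e ∈ E, lorentz e e = 1)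
    (hcod : HasCodim (polytopeOf E) 0) (hRight : IsRightAngled (polytopeOf E))
    {A B C : Set (Mink n)} {a b c w : Mink n} (hB : HasCodim B 1)
    (ha : IsOuterNormal (polytopeOf E) A a) (hb : IsOuterNormal (polytopeOf E) B b)
    (hc : IsOuterNormal (polytopeOf E) C c) (hab : lorentz b a = 0) (hbc : lorentz b c = 0)
    (hw : w ∈ causalCone E) (hwa : lorentz w a = 0) (hwc : lorentz w c = 0)
    (hneg : lorentz w w - lorentz w b ^ 2 < 0) : (A ∩ B ∩ C).Nonempty := by
  have h1 := project_mem_causalCone hE hcod hRight hB hb hw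
    (lorentz_outerNormal_nonpos hcod.1 hb hw)
  obtain ⟨t, -, hmem⟩ := exists_smul_mem_of_timelike h1 (by
    rw [lorentz_sub_left, lorentz_sub_right, lorentz_sub_right, lorentz_smul_left,
      lorentz_smul_left, lorentz_smul_right, lorentz_smul_right, hb.1, lorentz_comm b w]
    linarith)
  refine ⟨t • (w - lorentz w b • b), ⟨?_, ?_⟩, ?_⟩
  · rw [ha.2.2]
    refine ⟨hmem, ?_⟩
    rw [lorentz_smul_left, lorentz_sub_left, lorentz_smul_left, hwa, hab]; ring
  · rw [hb.2.2]
    refine ⟨hmem, ?_⟩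
    rw [lorentz_smul_left, lorentz_sub_left, lorentz_smul_left, hb.1]; ring
  · rw [hc.2.2]
    refine ⟨hmem, ?_⟩
    rw [lorentz_smul_left, lorentz_sub_left, lorentz_smul_left, hwc, hbc]; ring

/-- Three facets that pairwise meet in codimension two have a common point. -/
theorem inter_nonempty_of_shareCodimTwo (hE : ∀ e ∈ E, lorentz e e = 1)
    (hcod : HasCodim (polytopeOf E) 0) (hRight : IsRightAngled (polytopeOf E))
    {A B C : Set (Mink n)} (hA : IsFacet (polytopeOf E) A) (hB : IsFacet (polytopeOf E) B)
    (hC : IsFacet (polytopeOf E) C) (hAB : ShareCodimTwo A B) (hBC : ShareCodimTwo B C)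
    (hCA : ShareCodimTwo C A) : (A ∩ B ∩ C).Nonempty := by
  obtain ⟨a, ha⟩ := hA.2
  obtain ⟨b, hb⟩ := hB.2
  obtain ⟨c, hc⟩ := hC.2
  obtain ⟨w, hwC, hwA⟩ := hCA.1
  rw [hc.2.2] at hwC
  rw [ha.2.2] at hwA
  refine inter_nonempty_of_project hE hcod hRight hB.1 ha hb hc
    (by rw [lorentz_comm]; exact orthogonal_of_shareCodimTwo hRight hA hB hAB ha hb)
    (orthogonal_of_shareCodimTwo hRight hB hC hBC hb hc)
    (polytopeOf_subset_causalCone E hwC.1) hwA.2 hwC.2 ?_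
  rw [hwC.1.1.1]
  nlinarith [sq_nonneg (lorentz w b)]

/-- If two facets share an ideal vertex and both meet a third one in codimension two, then the
three have a common face. -/
theorem shareFaceThree_of_shareIdealVertex (hE : ∀ e ∈ E, lorentz e e = 1)
    (hcod : HasCodim (polytopeOf E) 0) (hRight : IsRightAngled (polytopeOf E))
    {A B C : Set (Mink n)} (hA : IsFacet (polytopeOf E) A) (hB : IsFacet (polytopeOf E) B)
    (hC : IsFacet (polytopeOf E) C) (hAB : ShareCodimTwo A B) (hBC : ShareCodimTwo B C)
    (hCA : ShareIdealVertex (polytopeOf E) C A) : ShareFaceThree (polytopeOf E) A B C := by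
  obtain ⟨a, ha⟩ := hA.2
  obtain ⟨b, hb⟩ := hB.2
  obtain ⟨c, hc⟩ := hC.2
  obtain ⟨v, hv, hvC, hvA⟩ := hCA
  obtain ⟨hv0, hvK⟩ := kleinClosure_subset _ subset_rfl hv.1.1
  have hperp : ∀ {D : Set (Mink n)} {d : Mink n}, IsOuterNormal (polytopeOf E) D d →
      v ∈ kleinClosure D → lorentz v d = 0 := by
    intro D d hd hvD
    refine closure_minimal ?_ (isClosed_eq (f := fun x : Mink n => lorentz x d)
      (continuous_lorentz continuous_id continuous_const) continuous_const) hvD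
    rintro _ ⟨x, hx, rfl⟩
    rw [hd.2.2] at hx
    change lorentz ((x 0)⁻¹ • x) d = 0
    rw [lorentz_smul_left, hx.2, mul_zero]
  by_cases hvb : lorentz v b = 0
  · refine Or.inr ⟨v, hv, hvA, ?_, hvC⟩
    have hne := hB.1.1
    rw [hb.2.2] at hne ⊢
    exact mem_kleinClosure hne hvK hv0 hvb
  · refine Or.inl (inter_nonempty_of_project hE hcod hRight hB.1 ha hb hc
      (by rw [lorentz_comm]; exact orthogonal_of_shareCodimTwo hRight hA hB hAB ha hb)
      (orthogonal_of_shareCodimTwo hRight hB hC hBC hb hc) hvK (hperp ha hvA) (hperp hc hvC) ?_)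
    have := pow_pos (abs_pos.2 hvb) 2
    rw [sq_abs] at this
    rw [hv.2]
    linarith

/-- In a cyclic sequence of four facets that meet consecutively in codimension two, some two
opposite facets share an ideal vertex. -/
theorem shareIdealVertex_of_quadrilateral (hE : ∀ e ∈ E, lorentz e e = 1)
    (hcod : HasCodim (polytopeOf E) 0) (hRight : IsRightAngled (polytopeOf E))
    (hideal : IsIdeal (polytopeOf E))
    {A B C D : Set (Mink n)} (hA : IsFacet (polytopeOf E) A) (hB : IsFacet (polytopeOf E) B)
    (hC : IsFacet (polytopeOf E) C) (hD : IsFacet (polytopeOf E) D) (hAC : A ≠ C) (hBD : B ≠ D)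
    (hAB : ShareCodimTwo A B) (hBC : ShareCodimTwo B C) (hCD : ShareCodimTwo C D)
    (hDA : ShareCodimTwo D A) :
    ShareIdealVertex (polytopeOf E) A C ∨ ShareIdealVertex (polytopeOf E) B D := by
  obtain ⟨a, ha⟩ := hA.2
  obtain ⟨b, hb⟩ := hB.2
  obtain ⟨c, hc⟩ := hC.2
  obtain ⟨d, hd⟩ := hD.2
  rcases le_or_gt (lorentz a c ^ 2) 1 with hac | hac
  · obtain ⟨w, hw, hw0, hwa, hwc⟩ :=
      exists_common_causal hE hcod hRight hA.1 hC.1 ha hc hAC hac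
    exact Or.inl (shareIdealVertex_of_mem hcod.1 hideal hA.1.1 hC.1.1 ha hc hw hw0 hwa hwc)
  rcases le_or_gt (lorentz b d ^ 2) 1 with hbd | hbd
  · obtain ⟨w, hw, hw0, hwb, hwd⟩ :=
      exists_common_causal hE hcod hRight hB.1 hD.1 hb hd hBD hbd
    exact Or.inr (shareIdealVertex_of_mem hcod.1 hideal hB.1.1 hD.1.1 hb hd hw hw0 hwb hwd)
  have hab := orthogonal_of_shareCodimTwo hRight hA hB hAB ha hb
  have hbc := orthogonal_of_shareCodimTwo hRight hB hC hBC hb hc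
  have hcd := orthogonal_of_shareCodimTwo hRight hC hD hCD hc hd
  have hda := orthogonal_of_shareCodimTwo hRight hD hA hDA hd ha
  -- The part of `f` orthogonal to `e` has square `1 - lorentz e f ^ 2`.
  have htime : ∀ {e f : Mink n}, lorentz e e = 1 → lorentz f f = 1 → 1 < lorentz e f ^ 2 →
      lorentz (f - lorentz e f • e) (f - lorentz e f • e) < 0 := by
    intro e f hee hff hef
    rw [lorentz_sub_left, lorentz_sub_right, lorentz_sub_right, lorentz_smul_left,
      lorentz_smul_left, lorentz_smul_right, lorentz_smul_right, hee, hff, lorentz_comm f e]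
    linarith
  refine absurd ?_ (lorentz_ne_zero_of_timelike (htime ha.1 hc.1 hac) (htime hb.1 hd.1 hbd))
  rw [lorentz_sub_left, lorentz_sub_right, lorentz_sub_right, lorentz_smul_left,
    lorentz_smul_left, lorentz_smul_right, lorentz_smul_right, hcd, lorentz_comm c b, hbc,
    lorentz_comm a d, hda, hab]
  ring

end RightAngled

/-! ### Excluding the circuits -/

theorem shareCodimTwo_of_card {n k : ℕ} {P : Set (Mink n)} {F : Fin (k + 0) → Set (Mink n)}
    (hF : IsCircuit P k 0 F) (i : Fin (k + 0)) :
    ShareCodimTwo (F i) (F (finRotate _ i)) := by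
  have h := Set.eq_of_subset_of_ncard_le
    (Set.subset_univ {i | ShareCodimTwo (F i) (F (finRotate _ i))})
    (by rw [hF.card_codimTwo, Set.ncard_univ, Nat.card_fin]; exact le_rfl)
  exact (Set.ext_iff.1 h i).2 trivial

end IdealPolytope

theorem mainTheorem6 (P : Set (IdealPolytope.Mink 4))
    (hP : IdealPolytope.IsPolytope P)
    (hIdeal : IdealPolytope.IsIdeal P)
    (hRight : IdealPolytope.IsRightAngled P) :
    ¬ IdealPolytope.ContainsCircuit P 3 0 ∧
      ¬ IdealPolytope.ContainsCircuit P 4 0 ∧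
      ¬ IdealPolytope.ContainsCircuit P 2 1 := by
  obtain ⟨⟨E, hE, hPE⟩, hcod⟩ := hP
  obtain rfl : P = IdealPolytope.polytopeOf E := hPE
  refine ⟨?_, ?_, ?_⟩
  · rintro ⟨F, hF⟩
    have hall := IdealPolytope.shareCodimTwo_of_card hF
    exact hF.no_three 0 1 2 (by decide) (by decide) (by decide)
      (Or.inl (IdealPolytope.inter_nonempty_of_shareCodimTwo hE hcod hRight (hF.facet 0)
        (hF.facet 1) (hF.facet 2) (hall 0) (hall 1) (hall 2)))
  · rintro ⟨F, hF⟩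
    have hall := IdealPolytope.shareCodimTwo_of_card hF
    rcases IdealPolytope.shareIdealVertex_of_quadrilateral hE hcod hRight hIdeal (hF.facet 0)
      (hF.facet 1) (hF.facet 2) (hF.facet 3) (hF.injective.ne (by decide))
      (hF.injective.ne (by decide)) (hall 0) (hall 1) (hall 2) (hall 3) with h | h
    · exact (hF.not_adjacent 0 2 (by decide) (by decide) (by decide)).2 h
    · exact (hF.not_adjacent 1 3 (by decide) (by decide) (by decide)).2 h
  · rintro ⟨F, hF⟩
    obtain ⟨i, hi⟩ := Set.ncard_eq_one.1 hF.card_idealVertex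
    have hmem : ∀ j, j ≠ i → IdealPolytope.ShareCodimTwo (F j) (F (finRotate _ j)) := by
      intro j hj
      by_contra hcon
      have : j ∈ ({i} : Set (Fin (2 + 1))) :=
        hi ▸ ⟨hcon, (hF.adjacent j).resolve_left hcon⟩
      exact hj this
    have hideal : i ∈ ({i} : Set (Fin (2 + 1))) := rfl
    rw [← hi] at hideal
    have hrot : ∀ j : Fin (2 + 1), finRotate _ j ≠ j ∧ finRotate _ (finRotate _ j) ≠ j ∧
        finRotate _ (finRotate _ (finRotate _ j)) = j := by decide
    obtain ⟨h1, h2, h3⟩ := hrot i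
    have hlast := hmem _ h2
    rw [h3] at hlast
    -- The middle facet is the one opposite the ideal pair: index `i` rotated twice.
    have := IdealPolytope.shareFaceThree_of_shareIdealVertex hE hcod hRight
      (hF.facet (finRotate _ i)) (hF.facet (finRotate _ (finRotate _ i))) (hF.facet i)
      (hmem _ h1) hlast hideal.2
    exact hF.no_three _ _ _ (hrot _).1.symm h2 h1 this
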